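/- Let $q$ be an odd prime power and let $Q$ be an elliptic quadratic form on a $6$-dimensional vector space $V$ over $\mathrm{GF}(q)$, that is, a non-degenerate quadratic form of Witt index $2$; let $Q^-(5,q)$ be the quadric it defines. Points, lines and hyperplanes are the subspaces of $V$ of dimension $1$, $2$ and $5$; a line of $Q^-(5,q)$ is a totally singular $2$-dimensional subspace; $\perp$ denotes orthogonality with respect to the polar form $b(u,v)=Q(u+v)-Q(u)-Q(v)$. Two distinct lines are concurrent if they have a common point. A hyperplane is non-degenerate if the restriction of $Q$ to it is non-degenerate. A flag $(B,l)$ consists of a line $l$ of $Q^-(5,q)$ and a point $B$ on $l$. Three lines $l_1,l_2,l_3$ of $Q^-(5,q)$ are in perspective if they are mutually skew and the spaces $T_i=l_i^\perp$ satisfy the following: each $T_i$ is a $4$-dimensional space which contains $l_i$ and is skew to the other two lines, and the three spaces $\Sigma_i=\langle l_i,\,T_j\cap T_k\rangle$, $\{i,j,k\}=\{1,2,3\}$, share a line. Let $l$ be a line of $Q^-(5,q)$, let $\Pi$ be a non-degenerate hyperplane not containing $l$, and put $B=l\cap\Pi$ and $\sigma=\langle l,\Pi^\perp\rangle\cap\Pi$.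 The involution $\tilde\sigma$ induced by $\Pi$ (with respect to $l$) maps each generator $g$ of the quadratic cone $B^\perp\cap\Pi\cap Q^-(5,q)$, i.e. each totally singular line $g$ through $B$ contained in $\Pi$, to the unique further totally singular line $g'\neq g$ through $B$ in the plane $\langle g,\sigma\rangle$. **Proposition.** Let $l_1,l_2,l_3$ be three distinct lines of $Q^-(5,q)$ spanning the whole space. Then $l_1,l_2,l_3$ are in perspective if and only if there are $i,j,k$ with $\{i,j,k\}=\{1,2,3\}$ and a point $B$ on $l_i$ such that $\tilde\sigma$, the involution induced with respect to $l_i$ by the non-degenerate hyperplane $\langle B,l_j,l_k\rangle$, maps the totally singular line through $B$ concurrent with $l_j$ to the totally singular line through $B$ concurrent with $l_k$. -/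

import Mathlib

namespace EllipticQuadric

variable {F V : Type*} [Field F] [AddCommGroup V] [Module F V]

/-- The polarity `W ↦ W^⊥` of the polar form `b(u, v) = Q (u + v) - Q u - Q v` of `Q`. -/
def perp (Q : QuadraticForm F V) (W : Submodule F V) : Submodule F V :=
  LinearMap.BilinForm.orthogonal Q.polarBilin W

/-- `W` is totally singular: `Q` vanishes on `W`. -/
def IsTotallySingular (Q : QuadraticForm F V) (W : Submodule F V) : Prop :=
  ∀ v ∈ W, Q v = 0

/-- `Q` is an elliptic quadratic form on a 6-dimensional space: it is non-degenerate and its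
Witt index (the largest dimension of a totally singular subspace) is `2`. Over a finite field the
totally singular subspaces of such a form are the points and lines of `Q^-(5,q)`. -/
structure IsElliptic (Q : QuadraticForm F V) : Prop where
  finrank_eq : Module.finrank F V = 6
  nondegenerate : Q.Nondegenerate
  wittIndex_eq : IsGreatest
    {d : ℕ | ∃ W : Submodule F V, IsTotallySingular Q W ∧ Module.finrank F W = d} 2

/-- A line of the quadric: a totally singular line, that is, a totally singular subspace of
vector space dimension `2`. -/
def IsSingularLine (Q : QuadraticForm F V) (m : Submodule F V) : Prop :=
  Module.finrank F m = 2 ∧ IsTotallySingular Q m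

/-- `(B, m)` is a flag of the quadric: `B` is a point on the totally singular line `m`. -/
def IsFlag (Q : QuadraticForm F V) (B m : Submodule F V) : Prop :=
  Module.finrank F B = 1 ∧ IsSingularLine Q m ∧ B ≤ m

/-- Two lines are concurrent: they are distinct and have a point in common. -/
def Concurrent (m n : Submodule F V) : Prop :=
  m ≠ n ∧ m ⊓ n ≠ ⊥

/-- The space `Σ_i = ⟨l_i, T_j ∩ T_k⟩`, where `i, j, k` are the three indices (here
`j = i + 1` and `k = i + 2` modulo `3`). -/
def perspSpace (l T : Fin 3 → Submodule F V) (i : Fin 3) : Submodule F V :=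
  l i ⊔ (T (i + 1) ⊓ T (i + 2))

/-- Three lines `l_0, l_1, l_2` and three subspaces `T_0, T_1, T_2` are in perspective: the lines
are mutually skew, `T_i` is a 4-dimensional space on `l_i` skew to the other two lines, and
`Σ_0`, `Σ_1`, `Σ_2` share a line. -/
structure InPerspectiveWith (l T : Fin 3 → Submodule F V) : Prop where
  finrank_line : ∀ i, Module.finrank F (l i) = 2
  skew : ∀ i j, i ≠ j → l i ⊓ l j = ⊥
  finrank_space : ∀ i, Module.finrank F (T i) = 4
  le_space : ∀ i, l i ≤ T i
  skew_space : ∀ i j, i ≠ j → T i ⊓ l j = ⊥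
  exists_line : ∃ m : Submodule F V, Module.finrank F m = 2 ∧ ∀ i, m ≤ perspSpace l T i

/-- Three lines of the quadric are in perspective: this is taken with `T_i = l_i^⊥`. -/
def InPerspective (Q : QuadraticForm F V) (l : Fin 3 → Submodule F V) : Prop :=
  InPerspectiveWith l (fun i => perp Q (l i))

/-- `H` is a non-degenerate hyperplane: a hyperplane to which `Q` restricts as a non-degenerate
quadratic form. -/
def IsNondegenerateHyperplane (Q : QuadraticForm F V) (H : Submodule F V) : Prop :=
  Module.finrank F H + 1 = Module.finrank F V ∧ (Q.restrict H).Nondegenerate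

/-- The line `σ = ⟨m, H^⊥⟩ ∩ H`. -/
def sigma (Q : QuadraticForm F V) (m H : Submodule F V) : Submodule F V :=
  (m ⊔ perp Q H) ⊓ H

/-- `g` is a generator of the quadratic cone cut out on the quadric by `B^⊥ ∩ H`: a totally
singular line through `B` contained in `B^⊥ ∩ H`. -/
def IsConeGenerator (Q : QuadraticForm F V) (B H g : Submodule F V) : Prop :=
  IsSingularLine Q g ∧ B ≤ g ∧ g ≤ perp Q B ⊓ H

/-- The graph of the involution `σ~` that a non-degenerate hyperplane `H` not containing the
totally singular line `m` induces, by means of the line `σ = ⟨m, H^⊥⟩ ∩ H`, on the generators of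
the cone cut out on the quadric by `B^⊥ ∩ H`, where `B = m ∩ H`. The image of a generator `g` is
the further generator `g'` in the plane `⟨g, σ⟩`; see `sigmaTilde_existsUnique` and
`sigmaTilde_symm`. -/
structure SigmaTilde (Q : QuadraticForm F V) (m H g g' : Submodule F V) : Prop where
  hyperplane : IsNondegenerateHyperplane Q H
  not_le : ¬ m ≤ H
  generator : IsConeGenerator Q (m ⊓ H) H g
  generator' : IsConeGenerator Q (m ⊓ H) H g'
  ne : g' ≠ g
  le_plane : g' ≤ g ⊔ sigma Q m H

theorem eq_span_pair {W : Submodule F V} (hW : Module.finrank F W = 2) {b v : V} (hb : b ∈ W)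
    (hv : v ∈ W) (hb0 : b ≠ 0) (hvb : v ∉ Submodule.span F {b}) :
    W = Submodule.span F {b, v} := by
  have : FiniteDimensional F W := Module.finite_of_finrank_pos (by omega)
  symm
  apply Submodule.eq_of_le_of_finrank_eq
  · rw [Submodule.span_le]
    rintro x (rfl | rfl)
    exacts [hb, hv]
  · rw [hW]
    have hli : LinearIndependent F ![b, v] := by
      rw [LinearIndependent.pair_iff' hb0]
      intro a h
      exact hvb (Submodule.mem_span_singleton.2 ⟨a, h⟩)
    have hr : Set.range ![b, v] = {b, v} := by
      ext x
      simp [eq_comm, or_comm]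
    have := finrank_span_eq_card hli
    rwa [hr, Fintype.card_fin] at this

section WellDefined

variable {Q : QuadraticForm F V} {m H g g' : Submodule F V}

theorem map_comb (a c : F) (x y : V) :
    Q (a • x + c • y) = a * a * Q x + c * c * Q y + a * c * QuadraticMap.polar Q x y := by
  rw [QuadraticMap.map_add Q, QuadraticMap.map_smul, QuadraticMap.map_smul,
    QuadraticMap.polar_smul_left, QuadraticMap.polar_smul_right]
  simp only [smul_eq_mul]
  ring

theorem polar_eq_zero {W : Submodule F V} (hW : IsTotallySingular Q W) {x y : V} (hx : x ∈ W)
    (hy : y ∈ W) : QuadraticMap.polar Q x y = 0 := by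
  rw [QuadraticMap.polar, hW _ (W.add_mem hx hy), hW _ hx, hW _ hy]
  simp

/-- A non-degenerate hyperplane is the polar of a non-singular point `⟨P⟩`. -/
theorem exists_pole (h2 : (2 : F) ≠ 0) (hQ : IsElliptic Q) (hH : IsNondegenerateHyperplane Q H) :
    ∃ P : V, perp Q H = Submodule.span F {P} ∧ Q P ≠ 0 ∧
      ∀ x, x ∈ H ↔ QuadraticMap.polar Q P x = 0 := by
  let _ : Invertible (2 : F) := invertibleOfNonzero h2
  have hfin : FiniteDimensional F V := Module.finite_of_finrank_pos (by rw [hQ.finrank_eq]; omega)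
  have hnd := QuadraticMap.nondegenerate_polar_iff.2 hQ.nondegenerate
  have hrefl : LinearMap.BilinForm.IsRefl Q.polarBilin := fun x y h => by
    rw [QuadraticMap.polarBilin_apply_apply] at h ⊢
    rwa [QuadraticMap.polar_comm]
  have h1 : Module.finrank F (perp Q H) = 1 := by
    have := LinearMap.BilinForm.finrank_orthogonal hnd H
    have h' := hH.1
    unfold perp
    omega
  obtain ⟨P, hP0, hP⟩ := finrank_eq_one_iff'.1 h1
  have hspan : perp Q H = Submodule.span F {(P : V)} := by
    apply le_antisymm
    · intro x hx
      obtain ⟨c, hc⟩ := hP ⟨x, hx⟩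
      exact Submodule.mem_span_singleton.2 ⟨c, by simpa using congrArg Subtype.val hc⟩
    · rw [Submodule.span_singleton_le_iff_mem]
      exact P.2
  have hmem : ∀ x, x ∈ H ↔ QuadraticMap.polar Q P x = 0 := by
    intro x
    have hoo := LinearMap.BilinForm.orthogonal_orthogonal hnd hrefl H
    change LinearMap.BilinForm.orthogonal Q.polarBilin (perp Q H) = H at hoo
    rw [hspan] at hoo
    nth_rewrite 1 [← hoo]
    rw [LinearMap.BilinForm.mem_orthogonal_iff]
    constructor
    · intro h
      exact h _ (Submodule.mem_span_singleton_self _)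
    · intro h n hn
      obtain ⟨c, rfl⟩ := Submodule.mem_span_singleton.1 hn
      rw [QuadraticMap.polarBilin_apply_apply, QuadraticMap.polar_smul_left, h, smul_zero]
  refine ⟨P, hspan, fun h0 => ?_, hmem⟩
  have hPH : (P : V) ∈ H := by
    rw [hmem, QuadraticMap.polar_self, h0, smul_zero]
  have hr : (⟨P, hPH⟩ : H) ∈ (Q.restrict H).radical := by
    rw [QuadraticMap.mem_radical_iff']
    refine ⟨h0, fun y => ?_⟩
    have hy : QuadraticMap.polar Q P y = 0 := (hmem y).1 y.2
    rw [QuadraticMap.polar, h0] at hy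
    simpa [sub_eq_zero] using hy
  rw [hH.2.radical_eq_bot, Submodule.mem_bot] at hr
  exact hP0 (Subtype.ext (congrArg (fun z : H => (z : V)) hr))

/-- Coordinates for a totally singular line `m`, a non-degenerate hyperplane `H` not on `m`, and a
generator `g` of the cone: `m ∩ H = ⟨b⟩`, `σ = ⟨b, s⟩` and `g = ⟨b, v⟩`. -/
theorem exists_coordinates (h2 : (2 : F) ≠ 0) (hQ : IsElliptic Q) (hm : IsSingularLine Q m)
    (hH : IsNondegenerateHyperplane Q H) (hmH : ¬ m ≤ H)
    (hg : IsConeGenerator Q (m ⊓ H) H g) :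
    ∃ b v s : V, b ≠ 0 ∧ m ⊓ H = Submodule.span F {b} ∧ v ∉ Submodule.span F {b} ∧
      g = Submodule.span F {b, v} ∧ sigma Q m H = Submodule.span F {b, s} ∧
      s ∈ H ∧ v ∈ H ∧ QuadraticMap.polar Q b s = 0 ∧ QuadraticMap.polar Q b v = 0 ∧
      Q b = 0 ∧ Q v = 0 ∧ Q s ≠ 0 ∧ QuadraticMap.polar Q v s ≠ 0 := by
  have hfin : FiniteDimensional F V := Module.finite_of_finrank_pos (by rw [hQ.finrank_eq]; omega)
  obtain ⟨P, hP, hQP, hmem⟩ := exists_pole h2 hQ hH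
  obtain ⟨c, hcm, hcH⟩ := Set.not_subset.1 hmH
  have hPc : QuadraticMap.polar Q P c ≠ 0 := fun h => hcH ((hmem c).2 h)
  obtain ⟨b, hbm, hbH, hb0⟩ : ∃ b, b ∈ m ∧ b ∈ H ∧ b ≠ 0 := by
    by_contra! hcon
    have hbot : m ⊓ H = ⊥ := by
      rw [eq_bot_iff]
      rintro x ⟨hx, hx'⟩
      exact hcon x hx hx'
    have h1 := Submodule.finrank_sup_add_finrank_inf_eq m H
    have h3 := Submodule.finrank_le (m ⊔ H)
    have h4 := hH.1
    have h5 := hm.1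
    rw [hbot, finrank_bot] at h1
    omega
  have hcb : c ∉ Submodule.span F {b} := by
    intro h
    obtain ⟨t, rfl⟩ := Submodule.mem_span_singleton.1 h
    exact hcH (H.smul_mem t hbH)
  have hmspan := eq_span_pair hm.1 hbm hcm hb0 hcb
  have hB : m ⊓ H = Submodule.span F {b} := by
    apply le_antisymm
    · rintro x ⟨hx, hxH⟩
      rw [SetLike.mem_coe, hmspan] at hx
      obtain ⟨t, u, rfl⟩ := Submodule.mem_span_pair.1 hx
      have h := (hmem _).1 hxH
      rw [QuadraticMap.polar_add_right, QuadraticMap.polar_smul_right,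
        QuadraticMap.polar_smul_right, (hmem b).1 hbH] at h
      have hu : u = 0 := by simpa [hPc] using h
      subst hu
      exact Submodule.mem_span_singleton.2 ⟨t, by simp⟩
    · rw [Submodule.span_singleton_le_iff_mem]
      exact ⟨hbm, hbH⟩
  have hbg : b ∈ g := hg.2.1 ⟨hbm, hbH⟩
  obtain ⟨v, hvg, hvb⟩ : ∃ v, v ∈ g ∧ v ∉ Submodule.span F {b} := by
    by_contra! hcon
    have h1 := Submodule.finrank_mono (show g ≤ Submodule.span F {b} from hcon)
    have h3 := finrank_span_singleton (K := F) hb0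
    have h4 := hg.1.1
    omega
  have hvH : v ∈ H := (hg.2.2 hvg).2
  have hgspan := eq_span_pair hg.1.1 hbg hvg hb0 hvb
  have hbv := polar_eq_zero hg.1.2 hbg hvg
  have hbc := polar_eq_zero hm.2 hbm hcm
  have hPb := (hmem b).1 hbH
  have hPv := (hmem v).1 hvH
  have hQb := hm.2 b hbm
  have hQc := hm.2 c hcm
  have hQv := hg.1.2 v hvg
  have hvc : QuadraticMap.polar Q v c ≠ 0 := by
    intro h0
    have hTS : IsTotallySingular Q (m ⊔ g) := by
      intro x hx
      obtain ⟨y, hy, z, hz, rfl⟩ := Submodule.mem_sup.1 hx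
      rw [hmspan] at hy
      rw [hgspan] at hz
      obtain ⟨t, u, rfl⟩ := Submodule.mem_span_pair.1 hy
      obtain ⟨t', u', rfl⟩ := Submodule.mem_span_pair.1 hz
      have e : t • b + u • c + (t' • b + u' • v) =
          (t + t') • b + (1 : F) • (u • c + u' • v) := by module
      rw [e, map_comb, map_comb, QuadraticMap.polar_add_right, QuadraticMap.polar_smul_right,
        QuadraticMap.polar_smul_right, hbc, hbv, hQb, hQc, hQv, QuadraticMap.polar_comm Q c v, h0]
      simp
    have hle := hQ.wittIndex_eq.2 ⟨_, hTS, rfl⟩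
    have hmeq : m = m ⊔ g := Submodule.eq_of_le_of_finrank_le le_sup_left (by rw [hm.1]; exact hle)
    have hvm : v ∈ m := by
      rw [hmeq]
      exact Submodule.mem_sup_right hvg
    have : v ∈ m ⊓ H := ⟨hvm, hvH⟩
    rw [hB] at this
    exact hvb this
  set t : F := 2 * Q P / QuadraticMap.polar Q P c with ht
  have htP : t * QuadraticMap.polar Q P c = 2 * Q P := by
    rw [ht]
    field_simp
  have ht0 : t ≠ 0 := div_ne_zero (mul_ne_zero h2 hQP) hPc
  have hPP : QuadraticMap.polar Q P P = 2 * Q P := by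
    rw [QuadraticMap.polar_self, nsmul_eq_mul, Nat.cast_ofNat]
  refine ⟨b, v, (1 : F) • P + (-t) • c, hb0, hB, hvb, hgspan, ?_, ?_, hvH, ?_, hbv, hQb, hQv,
    ?_, ?_⟩
  · have hsH : (1 : F) • P + (-t) • c ∈ H := by
      rw [hmem, QuadraticMap.polar_add_right, QuadraticMap.polar_smul_right,
        QuadraticMap.polar_smul_right, hPP, smul_eq_mul, smul_eq_mul]
      linear_combination -htP
    apply le_antisymm
    · rintro x ⟨hx, hxH⟩
      obtain ⟨y, hy, z, hz, rfl⟩ := Submodule.mem_sup.1 hx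
      rw [hmspan] at hy
      rw [hP] at hz
      obtain ⟨a, u, rfl⟩ := Submodule.mem_span_pair.1 hy
      obtain ⟨w, rfl⟩ := Submodule.mem_span_singleton.1 hz
      have h := (hmem _).1 hxH
      simp only [QuadraticMap.polar_add_right, QuadraticMap.polar_smul_right, hPb, hPP,
        smul_eq_mul] at h
      have hu : u = -(w * t) := by
        apply mul_right_cancel₀ hPc
        linear_combination h + w * htP
      refine Submodule.mem_span_pair.2 ⟨a, w, ?_⟩
      rw [hu]
      module
    · rw [Submodule.span_le]
      rintro x (rfl | rfl)
      · exact ⟨Submodule.mem_sup_left hbm, hbH⟩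
      · refine ⟨?_, hsH⟩
        refine (m ⊔ perp Q H).add_mem (Submodule.smul_mem _ _ (Submodule.mem_sup_right ?_))
          (Submodule.smul_mem _ _ (Submodule.mem_sup_left hcm))
        rw [hP]
        exact Submodule.mem_span_singleton_self P
  · rw [hmem, QuadraticMap.polar_add_right, QuadraticMap.polar_smul_right,
      QuadraticMap.polar_smul_right, hPP, smul_eq_mul, smul_eq_mul]
    linear_combination -htP
  · rw [QuadraticMap.polar_add_right, QuadraticMap.polar_smul_right,
      QuadraticMap.polar_smul_right, QuadraticMap.polar_comm Q b P, hPb, hbc]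
    simp
  · rw [map_comb, hQc]
    have : (1 : F) * 1 * Q P + -t * -t * 0 + 1 * -t * QuadraticMap.polar Q P c = -Q P := by
      linear_combination -htP
    rw [this]
    exact neg_ne_zero.2 hQP
  · rw [QuadraticMap.polar_add_right, QuadraticMap.polar_smul_right,
      QuadraticMap.polar_smul_right, QuadraticMap.polar_comm Q v P, hPv]
    simp [ht0, hvc]

/-- A generator of the cone has exactly one image: the involution is a well-defined map. -/
theorem sigmaTilde_existsUnique (h2 : (2 : F) ≠ 0) (hQ : IsElliptic Q) (hm : IsSingularLine Q m)
    (hH : IsNondegenerateHyperplane Q H) (hmH : ¬ m ≤ H)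
    (hg : IsConeGenerator Q (m ⊓ H) H g) : ∃! g', SigmaTilde Q m H g g' := by
  obtain ⟨b, v, s, hb0, hB, hvb, hgs, hσ, hsH, hvH, hbs, hbv, hQb, hQv, hQs, hvs⟩ :=
    exists_coordinates h2 hQ hm hH hmH hg
  set k := QuadraticMap.polar Q v s with hk
  have hbm : b ∈ m ⊓ H := by
    rw [hB]
    exact Submodule.mem_span_singleton_self b
  have hplane : ∀ x, x ∈ g ⊔ sigma Q m H → ∃ a c d : F, x = a • b + c • v + d • s := by
    intro x hx
    obtain ⟨y, hy, z, hz, rfl⟩ := Submodule.mem_sup.1 hx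
    rw [hgs] at hy
    rw [hσ] at hz
    obtain ⟨a, c, rfl⟩ := Submodule.mem_span_pair.1 hy
    obtain ⟨a', d, rfl⟩ := Submodule.mem_span_pair.1 hz
    exact ⟨a + a', c, d, by module⟩
  have hsg : s ∉ g := fun h => hQs (hg.1.2 s h)
  have hbg : b ∈ g := hg.2.1 hbm
  have hvg : v ∈ g := by
    rw [hgs]
    exact Submodule.mem_span_pair.2 ⟨0, 1, by simp⟩
  set u : V := (Q s) • v + (-k) • s with hu
  have hug : u ∉ g := by
    intro h
    have h' : (-k) • s ∈ g := by
      have := g.sub_mem h (g.smul_mem (Q s) hvg)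
      rwa [hu, add_sub_cancel_left] at this
    exact hsg ((g.smul_mem_iff (neg_ne_zero.2 hvs)).1 h')
  have hub : u ∉ Submodule.span F {b} := fun h =>
    hug ((Submodule.span_singleton_le_iff_mem b g).2 hbg h)
  have hQu : Q u = 0 := by
    rw [hu, map_comb, hQv, ← hk]
    ring
  have hbu : QuadraticMap.polar Q b u = 0 := by
    rw [hu, QuadraticMap.polar_add_right, QuadraticMap.polar_smul_right,
      QuadraticMap.polar_smul_right, hbs, hbv]
    simp
  have huH : u ∈ H := H.add_mem (H.smul_mem _ hvH) (H.smul_mem _ hsH)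
  have hug' : u ∈ Submodule.span F {b, u} := Submodule.mem_span_pair.2 ⟨0, 1, by simp⟩
  refine ⟨Submodule.span F {b, u}, ⟨hH, hmH, hg, ⟨⟨?_, ?_⟩, ?_, ?_⟩, ?_, ?_⟩, ?_⟩
  · have hli : LinearIndependent F ![b, u] := by
      rw [LinearIndependent.pair_iff' hb0]
      intro a h
      exact hub (Submodule.mem_span_singleton.2 ⟨a, h⟩)
    have hr : Set.range ![b, u] = {b, u} := by
      ext x
      simp [eq_comm, or_comm]
    have := finrank_span_eq_card hli
    rwa [hr, Fintype.card_fin] at this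
  · intro x hx
    obtain ⟨a, c, rfl⟩ := Submodule.mem_span_pair.1 hx
    rw [map_comb, hQb, hQu, hbu]
    ring
  · rw [hB, Submodule.span_singleton_le_iff_mem]
    exact Submodule.mem_span_pair.2 ⟨1, 0, by simp⟩
  · intro x hx
    obtain ⟨a, c, rfl⟩ := Submodule.mem_span_pair.1 hx
    refine ⟨?_, H.add_mem (H.smul_mem _ hbm.2) (H.smul_mem _ huH)⟩
    intro y hy
    rw [hB] at hy
    obtain ⟨d, rfl⟩ := Submodule.mem_span_singleton.1 hy
    have hbb : QuadraticMap.polar Q b b = 0 := by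
      rw [QuadraticMap.polar_self, hQb, smul_zero]
    change QuadraticMap.polar Q (d • b) (a • b + c • u) = 0
    rw [QuadraticMap.polar_smul_left, QuadraticMap.polar_add_right,
      QuadraticMap.polar_smul_right, QuadraticMap.polar_smul_right, hbb, hbu]
    simp
  · intro h
    rw [h] at hug'
    exact hug hug'
  · rw [Submodule.span_le]
    rintro x (rfl | rfl)
    · exact Submodule.mem_sup_left hbg
    · refine Submodule.add_mem _ (Submodule.smul_mem _ _ (Submodule.mem_sup_left hvg))
        (Submodule.smul_mem _ _ (Submodule.mem_sup_right ?_))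
      rw [hσ]
      exact Submodule.mem_span_pair.2 ⟨0, 1, by simp⟩
  · intro g' h
    have hbg' : b ∈ g' := h.generator'.2.1 hbm
    obtain ⟨w, hwg', hwg⟩ : ∃ w, w ∈ g' ∧ w ∉ g := by
      by_contra! hcon
      have hfin : FiniteDimensional F g := Module.finite_of_finrank_pos (by rw [hg.1.1]; omega)
      exact h.ne (Submodule.eq_of_le_of_finrank_eq hcon
        (by rw [hg.1.1, h.generator'.1.1]))
    obtain ⟨a, c, d, rfl⟩ := hplane w (h.le_plane hwg')
    have hd : d ≠ 0 := by
      rintro rfl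
      apply hwg
      rw [zero_smul, add_zero]
      exact g.add_mem (g.smul_mem _ hbg) (g.smul_mem _ hvg)
    have hw' : c • v + d • s ∈ g' := by
      have := g'.sub_mem hwg' (g'.smul_mem a hbg')
      rwa [add_assoc, add_sub_cancel_left] at this
    have hQw := h.generator'.1.2 _ hw'
    rw [map_comb, hQv, ← hk] at hQw
    have hck : c * k = -(d * Q s) := by
      apply mul_left_cancel₀ hd
      linear_combination hQw
    have hu' : u = (-(k / d)) • (c • v + d • s) := by
      have e1 : -(k / d) * c = Q s := by
        field_simp
        linear_combination -hck
      have e2 : -(k / d) * d = -k := by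
        field_simp
      rw [smul_add, smul_smul, smul_smul, e1, e2]
    have hug2 : u ∈ g' := by
      rw [hu']
      exact g'.smul_mem _ hw'
    exact eq_span_pair h.generator'.1.1 hbg' hug2 hb0 hub

/-- If `g'` is the image of `g`, then `g` is the image of `g'`: the map is an involution. -/
theorem sigmaTilde_symm (h2 : (2 : F) ≠ 0) (hQ : IsElliptic Q) (hm : IsSingularLine Q m)
    (h : SigmaTilde Q m H g g') : SigmaTilde Q m H g' g := by
  refine ⟨h.hyperplane, h.not_le, h.generator', h.generator, h.ne.symm, ?_⟩
  obtain ⟨b, v, s, hb0, hB, hvb, hgs, hσ, -, -, -, -, -, hQv, hQs, hvs⟩ :=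
    exists_coordinates h2 hQ hm h.hyperplane h.not_le h.generator'
  have hbm : b ∈ m ⊓ H := by
    rw [hB]
    exact Submodule.mem_span_singleton_self b
  have hbg := h.generator.2.1 hbm
  have hvg' : v ∈ g' := by
    rw [hgs]
    exact Submodule.mem_span_pair.2 ⟨0, 1, by simp⟩
  have hbg' := h.generator'.2.1 hbm
  obtain ⟨y, hy, z, hz, e⟩ := Submodule.mem_sup.1 (h.le_plane hvg')
  have hyb : y ∉ Submodule.span F {b} := by
    intro hyb
    obtain ⟨a, rfl⟩ := Submodule.mem_span_singleton.1 hyb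
    rw [hσ] at hz
    obtain ⟨a', d, rfl⟩ := Submodule.mem_span_pair.1 hz
    have hd : d = 0 := by
      by_contra hd
      have hs' : d • s ∈ g' := by
        have h1 := g'.sub_mem hvg' (g'.smul_mem (a + a') hbg')
        have h3 : v - (a + a') • b = d • s := by
          rw [← e]
          module
        rwa [h3] at h1
      exact hQs (h.generator'.1.2 s ((g'.smul_mem_iff hd).1 hs'))
    subst hd
    exact hvb (Submodule.mem_span_singleton.2 ⟨a + a', by rw [← e]; module⟩)
  rw [eq_span_pair h.generator.1.1 hbg hy hb0 hyb, Submodule.span_le]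
  rintro x (rfl | rfl)
  · exact Submodule.mem_sup_left hbg'
  · have h3 : x = v - z := by
      rw [← e]
      module
    rw [h3]
    exact Submodule.sub_mem _ (Submodule.mem_sup_left hvg') (Submodule.mem_sup_right hz)

end WellDefined

end EllipticQuadric

namespace EllipticQuadric

variable {F V : Type*} [Field F] [AddCommGroup V] [Module F V]
variable {Q : QuadraticForm F V} {m n r : Submodule F V}

/-! Both sides of the equivalence say that one 2 × 2 matrix is symmetric. The three lines span a
6-dimensional space, so they are mutually skew and form a direct sum. Since a totally singular line
is maximal, two skew ones are dually paired by the polar form (`exists_dual_pair`). Fix a basis `e₁,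
e₂` of one line and take the dual bases `f₁, f₂` and `g₁, g₂` of the other two. The only remaining
datum is the matrix A = `!![a, b; c, d]` pairing the `f`s with the `g`s. Witt index 2 makes the
quadratic form z ↦ zᵀAz anisotropic (`IsFrame.anisotropic`): for a suitable x, the vector x·e - z·f
+ z·g lies in the polar of the first line and has Q-value -zᵀAz.

Write a vector as x·e + y·f + z·g with x, y, z in F². It lies in the three spaces Σ_i exactly when
Az = Aᵀy, x = Aᵀz and x = Ay respectively. Together these give (A + Aᵀ)(y - z) = 0, so y = z by
anisotropy, and then (A - Aᵀ)y = 0. A common nonzero vector therefore forces A = Aᵀ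
(`IsFrame.symmetric_of_mem`). Conversely, if A is symmetric, the vectors Ay·e + y·f + y·g form a
common line (`IsFrame.exists_line_of_symmetric`).

For the flag, choose `e₁` spanning B. The totally singular lines through B meeting the other two
lines are ⟨e₁, f₂⟩ and ⟨e₁, g₂⟩. They correspond under the involution only if some f₂-multiple plus
g₂, corrected by a vector of the first line, is orthogonal to the whole hyperplane. Orthogonality to
the second and to the third line then gives b = c (`IsFrame.symmetric_of_le_sup_sigma`), and
symmetry conversely produces such a vector (`IsFrame.sigmaTilde`). Hence one flag suffices in one
direction, and any flag on the first line can be used in the other. -/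

/-! ### Polars and maximality of totally singular lines -/

theorem two_ne_zero_of_odd_card [Finite F] (hq : Odd (Nat.card F)) : (2 : F) ≠ 0 := by
  have := Fintype.ofFinite F
  intro h
  rw [Nat.card_eq_fintype_card] at hq
  have hc : ringChar F = 2 := by
    have hd : ringChar F ∣ 2 := (ringChar.spec F 2).1 (by exact_mod_cast h)
    rcases (Nat.dvd_prime Nat.prime_two).1 hd with h1 | h1
    · exact absurd h1 (CharP.ringChar_ne_one)
    · exact h1
  have := FiniteField.even_card_of_char_two hc
  rw [Nat.odd_iff] at hq
  omega

theorem mem_perp_iff {W : Submodule F V} {w : V} :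
    w ∈ perp Q W ↔ ∀ u ∈ W, QuadraticMap.polar Q u w = 0 := Iff.rfl

theorem mem_perp_sup {W W' : Submodule F V} {w : V} (hw : w ∈ perp Q W) (hw' : w ∈ perp Q W') :
    w ∈ perp Q (W ⊔ W') := by
  rw [mem_perp_iff] at *
  intro u hu
  obtain ⟨x, hx, y, hy, e⟩ := Submodule.mem_sup.1 hu
  rw [← e, QuadraticMap.polar_add_left, hw x hx, hw' y hy, add_zero]

theorem mem_perp_span_singleton {u w : V} (h : QuadraticMap.polar Q u w = 0) :
    w ∈ perp Q (Submodule.span F {u}) := by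
  rw [mem_perp_iff]
  intro x hx
  obtain ⟨t, ht⟩ := Submodule.mem_span_singleton.1 hx
  rw [← ht, QuadraticMap.polar_smul_left, h, smul_zero]

theorem mem_perp_span_pair {u v w : V} :
    w ∈ perp Q (Submodule.span F {u, v}) ↔
      QuadraticMap.polar Q u w = 0 ∧ QuadraticMap.polar Q v w = 0 := by
  constructor
  · intro h
    exact ⟨h u (Submodule.subset_span (by simp)), h v (Submodule.subset_span (by simp))⟩
  · rintro ⟨hu, hv⟩ x hx
    obtain ⟨s, t, rfl⟩ := Submodule.mem_span_pair.1 hx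
    change QuadraticMap.polar Q (s • u + t • v) w = 0
    rw [QuadraticMap.polar_add_left, QuadraticMap.polar_smul_left, QuadraticMap.polar_smul_left,
      hu, hv]
    simp

theorem IsElliptic.finiteDimensional (hQ : IsElliptic Q) : FiniteDimensional F V :=
  Module.finite_of_finrank_pos (by rw [hQ.finrank_eq]; omega)

/-- A totally singular line is a maximal totally singular subspace. -/
theorem IsSingularLine.mem_of_perp (hQ : IsElliptic Q) (hm : IsSingularLine Q m) {w : V}
    (hw : ∀ x ∈ m, QuadraticMap.polar Q x w = 0) (hQw : Q w = 0) : w ∈ m := by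
  have := hQ.finiteDimensional
  have hTS : IsTotallySingular Q (m ⊔ Submodule.span F {w}) := by
    intro x hx
    obtain ⟨y, hy, z, hz, rfl⟩ := Submodule.mem_sup.1 hx
    obtain ⟨t, rfl⟩ := Submodule.mem_span_singleton.1 hz
    rw [QuadraticMap.map_add Q, QuadraticMap.map_smul, QuadraticMap.polar_smul_right, hm.2 y hy,
      hw y hy, hQw]
    simp
  have hle := hQ.wittIndex_eq.2 ⟨_, hTS, rfl⟩
  have hmeq : m = m ⊔ Submodule.span F {w} :=
    Submodule.eq_of_le_of_finrank_le le_sup_left (by rw [hm.1]; exact hle)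
  rw [hmeq]
  exact Submodule.mem_sup_right (Submodule.mem_span_singleton_self w)

theorem finrank_span_pair_eq_two {u v : V} (h : LinearIndependent F ![u, v]) :
    Module.finrank F (Submodule.span F {u, v}) = 2 := by
  have hr : Set.range ![u, v] = {u, v} := by
    ext x
    simp [eq_comm, or_comm]
  have := finrank_span_eq_card h
  rwa [hr, Fintype.card_fin] at this

/-! ### Dual bases and coordinates for three lines -/

/-- Two skew totally singular lines are dually paired by the polar form. -/
theorem exists_dual_pair (hQ : IsElliptic Q) (hm : IsSingularLine Q m) (hn : IsSingularLine Q n)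
    (hmn : m ⊓ n = ⊥) {e₁ e₂ : V} (he : m = Submodule.span F {e₁, e₂}) :
    ∃ f₁ f₂ : V, n = Submodule.span F {f₁, f₂} ∧
      QuadraticMap.polar Q e₁ f₁ = 1 ∧ QuadraticMap.polar Q e₁ f₂ = 0 ∧
      QuadraticMap.polar Q e₂ f₁ = 0 ∧ QuadraticMap.polar Q e₂ f₂ = 1 := by
  have := hQ.finiteDimensional
  let φ : n →ₗ[F] F × F :=
    ((Q.polarBilin e₁).prod (Q.polarBilin e₂)).comp n.subtype
  have hφ : ∀ y : n, φ y = (QuadraticMap.polar Q e₁ y, QuadraticMap.polar Q e₂ y) := fun y => rfl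
  -- A kernel vector is singular and orthogonal to `m`, so maximality of `m` puts it in `m ⊓ n`.
  -- Both sides have dimension 2, so injectivity gives surjectivity, and the dual basis consists of
  -- preimages of the unit vectors.
  have hinj : Function.Injective φ := by
    rw [← LinearMap.ker_eq_bot, LinearMap.ker_eq_bot']
    intro y hy
    rw [hφ, Prod.mk_eq_zero] at hy
    have hym : (y : V) ∈ m := by
      apply hm.mem_of_perp hQ _ (hn.2 y y.2)
      rw [he]
      exact mem_perp_span_pair.2 hy
    have : (y : V) ∈ m ⊓ n := ⟨hym, y.2⟩
    rw [hmn, Submodule.mem_bot] at this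
    exact Subtype.ext this
  have hsurj : Function.Surjective φ :=
    (LinearMap.injective_iff_surjective_of_finrank_eq_finrank (by
      rw [hn.1, Module.finrank_prod, Module.finrank_self])).1 hinj
  obtain ⟨f₁, h₁⟩ := hsurj (1, 0)
  obtain ⟨f₂, h₂⟩ := hsurj (0, 1)
  rw [hφ, Prod.mk.injEq] at h₁ h₂
  refine ⟨f₁, f₂, eq_span_pair hn.1 f₁.2 f₂.2 ?_ ?_, h₁.1, h₂.1, h₁.2, h₂.2⟩
  · intro h
    have := h₁.1
    rw [h, QuadraticMap.polar_zero_right] at this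
    exact zero_ne_one this
  · intro h
    obtain ⟨t, ht⟩ := Submodule.mem_span_singleton.1 h
    have := h₂.2
    rw [← ht, QuadraticMap.polar_smul_right, h₁.2, smul_zero] at this
    exact zero_ne_one this

/-- Bases of three totally singular lines that are dual with respect to the polar form, where
`!![a, b; c, d]` is the matrix of the pairing of the second line with the third. -/
structure IsFrame (Q : QuadraticForm F V) (m n r : Submodule F V) (e₁ e₂ f₁ f₂ g₁ g₂ : V)
    (a b c d : F) : Prop where
  eq_m : m = Submodule.span F {e₁, e₂}
  eq_n : n = Submodule.span F {f₁, f₂}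
  eq_r : r = Submodule.span F {g₁, g₂}
  singular_m : IsTotallySingular Q m
  singular_n : IsTotallySingular Q n
  singular_r : IsTotallySingular Q r
  ef₁₁ : QuadraticMap.polar Q e₁ f₁ = 1
  ef₁₂ : QuadraticMap.polar Q e₁ f₂ = 0
  ef₂₁ : QuadraticMap.polar Q e₂ f₁ = 0
  ef₂₂ : QuadraticMap.polar Q e₂ f₂ = 1
  eg₁₁ : QuadraticMap.polar Q e₁ g₁ = 1
  eg₁₂ : QuadraticMap.polar Q e₁ g₂ = 0
  eg₂₁ : QuadraticMap.polar Q e₂ g₁ = 0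
  eg₂₂ : QuadraticMap.polar Q e₂ g₂ = 1
  fg₁₁ : QuadraticMap.polar Q f₁ g₁ = a
  fg₁₂ : QuadraticMap.polar Q f₁ g₂ = b
  fg₂₁ : QuadraticMap.polar Q f₂ g₁ = c
  fg₂₂ : QuadraticMap.polar Q f₂ g₂ = d
  sup_eq_top : m ⊔ n ⊔ r = ⊤

namespace IsFrame

variable {e₁ e₂ f₁ f₂ g₁ g₂ : V} {a b c d : F}

/-- Each line is totally singular, so only the cross terms survive: the identity matrix for `e` with
`f` and `e` with `g`, and A for `f` with `g`. The six coordinate functionals below are special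
cases. -/
theorem polar_comb (h : IsFrame Q m n r e₁ e₂ f₁ f₂ g₁ g₂ a b c d)
    (x₁ x₂ y₁ y₂ z₁ z₂ x₁' x₂' y₁' y₂' z₁' z₂' : F) :
    QuadraticMap.polar Q (x₁ • e₁ + x₂ • e₂ + (y₁ • f₁ + y₂ • f₂) + (z₁ • g₁ + z₂ • g₂))
      (x₁' • e₁ + x₂' • e₂ + (y₁' • f₁ + y₂' • f₂) + (z₁' • g₁ + z₂' • g₂)) =
    x₁ * (y₁' + z₁') + x₂ * (y₂' + z₂') +
      y₁ * (x₁' + a * z₁' + b * z₂') + y₂ * (x₂' + c * z₁' + d * z₂') +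
      z₁ * (x₁' + a * y₁' + c * y₂') + z₂ * (x₂' + b * y₁' + d * y₂') := by
  have he₁ : e₁ ∈ m := by rw [h.eq_m]; exact Submodule.subset_span (by simp)
  have he₂ : e₂ ∈ m := by rw [h.eq_m]; exact Submodule.subset_span (by simp)
  have hf₁ : f₁ ∈ n := by rw [h.eq_n]; exact Submodule.subset_span (by simp)
  have hf₂ : f₂ ∈ n := by rw [h.eq_n]; exact Submodule.subset_span (by simp)
  have hg₁ : g₁ ∈ r := by rw [h.eq_r]; exact Submodule.subset_span (by simp)
  have hg₂ : g₂ ∈ r := by rw [h.eq_r]; exact Submodule.subset_span (by simp)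
  simp only [QuadraticMap.polar_add_left, QuadraticMap.polar_add_right,
    QuadraticMap.polar_smul_left, QuadraticMap.polar_smul_right, smul_eq_mul,
    polar_eq_zero h.singular_m he₁ he₁, polar_eq_zero h.singular_m he₁ he₂,
    polar_eq_zero h.singular_m he₂ he₁, polar_eq_zero h.singular_m he₂ he₂,
    polar_eq_zero h.singular_n hf₁ hf₁, polar_eq_zero h.singular_n hf₁ hf₂,
    polar_eq_zero h.singular_n hf₂ hf₁, polar_eq_zero h.singular_n hf₂ hf₂,
    polar_eq_zero h.singular_r hg₁ hg₁, polar_eq_zero h.singular_r hg₁ hg₂,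
    polar_eq_zero h.singular_r hg₂ hg₁, polar_eq_zero h.singular_r hg₂ hg₂,
    QuadraticMap.polar_comm Q f₁ e₁, QuadraticMap.polar_comm Q f₁ e₂,
    QuadraticMap.polar_comm Q f₂ e₁, QuadraticMap.polar_comm Q f₂ e₂,
    QuadraticMap.polar_comm Q g₁ e₁, QuadraticMap.polar_comm Q g₁ e₂,
    QuadraticMap.polar_comm Q g₂ e₁, QuadraticMap.polar_comm Q g₂ e₂,
    QuadraticMap.polar_comm Q g₁ f₁, QuadraticMap.polar_comm Q g₁ f₂,
    QuadraticMap.polar_comm Q g₂ f₁, QuadraticMap.polar_comm Q g₂ f₂,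
    h.ef₁₁, h.ef₁₂, h.ef₂₁, h.ef₂₂, h.eg₁₁, h.eg₁₂, h.eg₂₁, h.eg₂₂, h.fg₁₁, h.fg₁₂, h.fg₂₁, h.fg₂₂]
  ring

theorem polar_e₁ (h : IsFrame Q m n r e₁ e₂ f₁ f₂ g₁ g₂ a b c d) (x₁ x₂ y₁ y₂ z₁ z₂ : F) :
    QuadraticMap.polar Q e₁
      (x₁ • e₁ + x₂ • e₂ + (y₁ • f₁ + y₂ • f₂) + (z₁ • g₁ + z₂ • g₂)) = y₁ + z₁ := by
  simpa using h.polar_comb 1 0 0 0 0 0 x₁ x₂ y₁ y₂ z₁ z₂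

theorem polar_e₂ (h : IsFrame Q m n r e₁ e₂ f₁ f₂ g₁ g₂ a b c d) (x₁ x₂ y₁ y₂ z₁ z₂ : F) :
    QuadraticMap.polar Q e₂
      (x₁ • e₁ + x₂ • e₂ + (y₁ • f₁ + y₂ • f₂) + (z₁ • g₁ + z₂ • g₂)) = y₂ + z₂ := by
  simpa using h.polar_comb 0 1 0 0 0 0 x₁ x₂ y₁ y₂ z₁ z₂

theorem polar_f₁ (h : IsFrame Q m n r e₁ e₂ f₁ f₂ g₁ g₂ a b c d) (x₁ x₂ y₁ y₂ z₁ z₂ : F) :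
    QuadraticMap.polar Q f₁
      (x₁ • e₁ + x₂ • e₂ + (y₁ • f₁ + y₂ • f₂) + (z₁ • g₁ + z₂ • g₂)) =
        x₁ + a * z₁ + b * z₂ := by
  simpa using h.polar_comb 0 0 1 0 0 0 x₁ x₂ y₁ y₂ z₁ z₂

theorem polar_f₂ (h : IsFrame Q m n r e₁ e₂ f₁ f₂ g₁ g₂ a b c d) (x₁ x₂ y₁ y₂ z₁ z₂ : F) :
    QuadraticMap.polar Q f₂
      (x₁ • e₁ + x₂ • e₂ + (y₁ • f₁ + y₂ • f₂) + (z₁ • g₁ + z₂ • g₂)) =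
        x₂ + c * z₁ + d * z₂ := by
  simpa using h.polar_comb 0 0 0 1 0 0 x₁ x₂ y₁ y₂ z₁ z₂

theorem polar_g₁ (h : IsFrame Q m n r e₁ e₂ f₁ f₂ g₁ g₂ a b c d) (x₁ x₂ y₁ y₂ z₁ z₂ : F) :
    QuadraticMap.polar Q g₁
      (x₁ • e₁ + x₂ • e₂ + (y₁ • f₁ + y₂ • f₂) + (z₁ • g₁ + z₂ • g₂)) =
        x₁ + a * y₁ + c * y₂ := by
  simpa using h.polar_comb 0 0 0 0 1 0 x₁ x₂ y₁ y₂ z₁ z₂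

theorem polar_g₂ (h : IsFrame Q m n r e₁ e₂ f₁ f₂ g₁ g₂ a b c d) (x₁ x₂ y₁ y₂ z₁ z₂ : F) :
    QuadraticMap.polar Q g₂
      (x₁ • e₁ + x₂ • e₂ + (y₁ • f₁ + y₂ • f₂) + (z₁ • g₁ + z₂ • g₂)) =
        x₂ + b * y₁ + d * y₂ := by
  simpa using h.polar_comb 0 0 0 0 0 1 x₁ x₂ y₁ y₂ z₁ z₂

theorem exists_coords (h : IsFrame Q m n r e₁ e₂ f₁ f₂ g₁ g₂ a b c d) (v : V) :
    ∃ x₁ x₂ y₁ y₂ z₁ z₂ : F,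
      v = x₁ • e₁ + x₂ • e₂ + (y₁ • f₁ + y₂ • f₂) + (z₁ • g₁ + z₂ • g₂) := by
  have hv : v ∈ m ⊔ n ⊔ r := by rw [h.sup_eq_top]; trivial
  obtain ⟨w, hw, z, hz, rfl⟩ := Submodule.mem_sup.1 hv
  obtain ⟨x, hx, y, hy, rfl⟩ := Submodule.mem_sup.1 hw
  rw [h.eq_m] at hx
  rw [h.eq_n] at hy
  rw [h.eq_r] at hz
  obtain ⟨x₁, x₂, rfl⟩ := Submodule.mem_span_pair.1 hx
  obtain ⟨y₁, y₂, rfl⟩ := Submodule.mem_span_pair.1 hy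
  obtain ⟨z₁, z₂, rfl⟩ := Submodule.mem_span_pair.1 hz
  exact ⟨x₁, x₂, y₁, y₂, z₁, z₂, rfl⟩

theorem map_comb_eq (h2 : (2 : F) ≠ 0) (h : IsFrame Q m n r e₁ e₂ f₁ f₂ g₁ g₂ a b c d)
    (x₁ x₂ y₁ y₂ z₁ z₂ : F) :
    Q (x₁ • e₁ + x₂ • e₂ + (y₁ • f₁ + y₂ • f₂) + (z₁ • g₁ + z₂ • g₂)) =
      x₁ * (y₁ + z₁) + x₂ * (y₂ + z₂) + y₁ * (a * z₁ + b * z₂) + y₂ * (c * z₁ + d * z₂) := by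
  have := h.polar_comb x₁ x₂ y₁ y₂ z₁ z₂ x₁ x₂ y₁ y₂ z₁ z₂
  rw [QuadraticMap.polar_self, nsmul_eq_mul, Nat.cast_ofNat] at this
  -- Q is recovered from the polar form through b(v, v) = 2 Q(v).
  apply mul_left_cancel₀ h2
  linear_combination this

theorem mem_perp_m (h : IsFrame Q m n r e₁ e₂ f₁ f₂ g₁ g₂ a b c d) {x₁ x₂ y₁ y₂ z₁ z₂ : F} :
    x₁ • e₁ + x₂ • e₂ + (y₁ • f₁ + y₂ • f₂) + (z₁ • g₁ + z₂ • g₂) ∈ perp Q m ↔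
      y₁ + z₁ = 0 ∧ y₂ + z₂ = 0 := by
  rw [h.eq_m, mem_perp_span_pair, h.polar_e₁, h.polar_e₂]

theorem mem_perp_n (h : IsFrame Q m n r e₁ e₂ f₁ f₂ g₁ g₂ a b c d) {x₁ x₂ y₁ y₂ z₁ z₂ : F} :
    x₁ • e₁ + x₂ • e₂ + (y₁ • f₁ + y₂ • f₂) + (z₁ • g₁ + z₂ • g₂) ∈ perp Q n ↔
      x₁ + a * z₁ + b * z₂ = 0 ∧ x₂ + c * z₁ + d * z₂ = 0 := by
  rw [h.eq_n, mem_perp_span_pair, h.polar_f₁, h.polar_f₂]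

theorem mem_perp_r (h : IsFrame Q m n r e₁ e₂ f₁ f₂ g₁ g₂ a b c d) {x₁ x₂ y₁ y₂ z₁ z₂ : F} :
    x₁ • e₁ + x₂ • e₂ + (y₁ • f₁ + y₂ • f₂) + (z₁ • g₁ + z₂ • g₂) ∈ perp Q r ↔
      x₁ + a * y₁ + c * y₂ = 0 ∧ x₂ + b * y₁ + d * y₂ = 0 := by
  rw [h.eq_r, mem_perp_span_pair, h.polar_g₁, h.polar_g₂]

/-- The six frame vectors span a 6-dimensional space, hence are independent. This justifies
comparing coefficients. -/
theorem coords_eq_zero (hQ : IsElliptic Q) (h : IsFrame Q m n r e₁ e₂ f₁ f₂ g₁ g₂ a b c d)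
    {x₁ x₂ y₁ y₂ z₁ z₂ : F}
    (h0 : x₁ • e₁ + x₂ • e₂ + (y₁ • f₁ + y₂ • f₂) + (z₁ • g₁ + z₂ • g₂) = 0) :
    x₁ = 0 ∧ x₂ = 0 ∧ y₁ = 0 ∧ y₂ = 0 ∧ z₁ = 0 ∧ z₂ = 0 := by
  have hli : LinearIndependent F ![e₁, e₂, f₁, f₂, g₁, g₂] := by
    apply linearIndependent_of_top_le_span_of_card_eq_finrank
    · intro v _
      obtain ⟨x₁, x₂, y₁, y₂, z₁, z₂, rfl⟩ := h.exists_coords v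
      rw [Submodule.mem_span_range_iff_exists_fun]
      refine ⟨![x₁, x₂, y₁, y₂, z₁, z₂], ?_⟩
      simp [Fin.sum_univ_succ]
      abel
    · rw [hQ.finrank_eq, Fintype.card_fin]
  rw [Fintype.linearIndependent_iff] at hli
  have hz := hli ![x₁, x₂, y₁, y₂, z₁, z₂] (by
    rw [← h0]
    simp [Fin.sum_univ_succ]
    abel)
  exact ⟨hz 0, hz 1, hz 2, hz 3, hz 4, hz 5⟩

/-- The pairing of the second line with the third is anisotropic, because the polar of the span of
the first two lines is. -/
theorem anisotropic (h2 : (2 : F) ≠ 0) (hQ : IsElliptic Q) (hm : IsSingularLine Q m)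
    (h : IsFrame Q m n r e₁ e₂ f₁ f₂ g₁ g₂ a b c d) (s t : F)
    (hst : a * s * s + (b + c) * s * t + d * t * t = 0) : s = 0 ∧ t = 0 := by
  -- Opposite `f`- and `g`-coordinates give orthogonality to `m` and Q-value -zᵀAz, where z = (s,
  -- t). A zero of the form thus gives a vector of `m`, whose `g`-coordinates must vanish.
  have hw := hm.mem_of_perp hQ
    (w := (-(a * s + b * t)) • e₁ + (-(c * s + d * t)) • e₂ + ((-s) • f₁ + (-t) • f₂) +
      (s • g₁ + t • g₂))
    (h.mem_perp_m.2 ⟨by ring, by ring⟩)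
    (by rw [h.map_comb_eq h2]; linear_combination -hst)
  rw [h.eq_m] at hw
  obtain ⟨x₁, x₂, hx⟩ := Submodule.mem_span_pair.1 hw
  obtain ⟨-, -, -, -, hs, ht⟩ := h.coords_eq_zero hQ (x₁ := -(a * s + b * t) - x₁)
    (x₂ := -(c * s + d * t) - x₂) (y₁ := -s) (y₂ := -t) (z₁ := s) (z₂ := t)
    (by rw [← sub_eq_zero.2 hx.symm]; module)
  exact ⟨hs, ht⟩

/-! ### The three spaces Σ_i in coordinates, and symmetry of the pairing -/

theorem mem_m_iff (h : IsFrame Q m n r e₁ e₂ f₁ f₂ g₁ g₂ a b c d) {v : V} :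
    v ∈ m ↔ ∃ x₁ x₂ : F, x₁ • e₁ + x₂ • e₂ = v := by
  rw [h.eq_m, Submodule.mem_span_pair]

theorem mem_n_iff (h : IsFrame Q m n r e₁ e₂ f₁ f₂ g₁ g₂ a b c d) {v : V} :
    v ∈ n ↔ ∃ y₁ y₂ : F, y₁ • f₁ + y₂ • f₂ = v := by
  rw [h.eq_n, Submodule.mem_span_pair]

theorem mem_r_iff (h : IsFrame Q m n r e₁ e₂ f₁ f₂ g₁ g₂ a b c d) {v : V} :
    v ∈ r ↔ ∃ z₁ z₂ : F, z₁ • g₁ + z₂ • g₂ = v := by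
  rw [h.eq_r, Submodule.mem_span_pair]

/-- The space spanned by the first line and the common polar of the other two. -/
theorem mem_sup_perp_m (h : IsFrame Q m n r e₁ e₂ f₁ f₂ g₁ g₂ a b c d) {x₁ x₂ y₁ y₂ z₁ z₂ : F} :
    x₁ • e₁ + x₂ • e₂ + (y₁ • f₁ + y₂ • f₂) + (z₁ • g₁ + z₂ • g₂) ∈
        m ⊔ (perp Q n ⊓ perp Q r) ↔
      a * z₁ + b * z₂ = a * y₁ + c * y₂ ∧ c * z₁ + d * z₂ = b * y₁ + d * y₂ := by
  constructor
  · intro hv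
    obtain ⟨u, hu, w, hw, hv⟩ := Submodule.mem_sup.1 hv
    obtain ⟨s, t, rfl⟩ := h.mem_m_iff.1 hu
    have hw' : w = (x₁ - s) • e₁ + (x₂ - t) • e₂ + (y₁ • f₁ + y₂ • f₂) +
        (z₁ • g₁ + z₂ • g₂) := by
      rw [← add_right_inj (s • e₁ + t • e₂), hv]
      module
    rw [hw', Submodule.mem_inf, h.mem_perp_n, h.mem_perp_r] at hw
    obtain ⟨⟨k₁, k₂⟩, k₃, k₄⟩ := hw
    exact ⟨by linear_combination k₁ - k₃, by linear_combination k₂ - k₄⟩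
  · rintro ⟨k₁, k₂⟩
    -- The `y` and `z` coordinates must come from the common polar; orthogonality to `n` then forces
    -- its `e`-part to be -Az, and the rest of the `e`-part is left to `m`.
    refine Submodule.mem_sup.2 ⟨(x₁ + a * z₁ + b * z₂) • e₁ + (x₂ + c * z₁ + d * z₂) • e₂,
      h.mem_m_iff.2 ⟨_, _, rfl⟩,
      (-(a * z₁ + b * z₂)) • e₁ + (-(c * z₁ + d * z₂)) • e₂ + (y₁ • f₁ + y₂ • f₂) +
        (z₁ • g₁ + z₂ • g₂), ?_, by module⟩
    rw [Submodule.mem_inf, h.mem_perp_n, h.mem_perp_r]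
    exact ⟨⟨by ring, by ring⟩, by linear_combination -k₁, by linear_combination -k₂⟩

/-- The space spanned by the second line and the common polar of the other two. -/
theorem mem_sup_perp_n (h : IsFrame Q m n r e₁ e₂ f₁ f₂ g₁ g₂ a b c d) {x₁ x₂ y₁ y₂ z₁ z₂ : F} :
    x₁ • e₁ + x₂ • e₂ + (y₁ • f₁ + y₂ • f₂) + (z₁ • g₁ + z₂ • g₂) ∈
        n ⊔ (perp Q m ⊓ perp Q r) ↔
      x₁ = a * z₁ + c * z₂ ∧ x₂ = b * z₁ + d * z₂ := by
  constructor
  · intro hv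
    obtain ⟨u, hu, w, hw, hv⟩ := Submodule.mem_sup.1 hv
    obtain ⟨s, t, rfl⟩ := h.mem_n_iff.1 hu
    have hw' : w = x₁ • e₁ + x₂ • e₂ + ((y₁ - s) • f₁ + (y₂ - t) • f₂) +
        (z₁ • g₁ + z₂ • g₂) := by
      rw [← add_right_inj (s • f₁ + t • f₂), hv]
      module
    rw [hw', Submodule.mem_inf, h.mem_perp_m, h.mem_perp_r] at hw
    obtain ⟨⟨k₁, k₂⟩, k₃, k₄⟩ := hw
    exact ⟨by linear_combination k₃ - a * k₁ - c * k₂, by linear_combination k₄ - b * k₁ - d * k₂⟩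
  · rintro ⟨k₁, k₂⟩
    -- Orthogonality to `m` forces the `f`-part of the common polar vector to be -z, which leaves y
    -- + z for `n`.
    refine Submodule.mem_sup.2 ⟨(y₁ + z₁) • f₁ + (y₂ + z₂) • f₂, h.mem_n_iff.2 ⟨_, _, rfl⟩,
      x₁ • e₁ + x₂ • e₂ + ((-z₁) • f₁ + (-z₂) • f₂) + (z₁ • g₁ + z₂ • g₂), ?_, by module⟩
    rw [Submodule.mem_inf, h.mem_perp_m, h.mem_perp_r]
    exact ⟨⟨by ring, by ring⟩, by linear_combination k₁, by linear_combination k₂⟩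

/-- The space spanned by the third line and the common polar of the other two. -/
theorem mem_sup_perp_r (h : IsFrame Q m n r e₁ e₂ f₁ f₂ g₁ g₂ a b c d) {x₁ x₂ y₁ y₂ z₁ z₂ : F} :
    x₁ • e₁ + x₂ • e₂ + (y₁ • f₁ + y₂ • f₂) + (z₁ • g₁ + z₂ • g₂) ∈
        r ⊔ (perp Q m ⊓ perp Q n) ↔
      x₁ = a * y₁ + b * y₂ ∧ x₂ = c * y₁ + d * y₂ := by
  constructor
  · intro hv
    obtain ⟨u, hu, w, hw, hv⟩ := Submodule.mem_sup.1 hv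
    obtain ⟨s, t, rfl⟩ := h.mem_r_iff.1 hu
    have hw' : w = x₁ • e₁ + x₂ • e₂ + (y₁ • f₁ + y₂ • f₂) +
        ((z₁ - s) • g₁ + (z₂ - t) • g₂) := by
      rw [← add_right_inj (s • g₁ + t • g₂), hv]
      module
    rw [hw', Submodule.mem_inf, h.mem_perp_m, h.mem_perp_n] at hw
    obtain ⟨⟨k₁, k₂⟩, k₃, k₄⟩ := hw
    exact ⟨by linear_combination k₃ - a * k₁ - b * k₂, by linear_combination k₄ - c * k₁ - d * k₂⟩
  · rintro ⟨k₁, k₂⟩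
    refine Submodule.mem_sup.2 ⟨(y₁ + z₁) • g₁ + (y₂ + z₂) • g₂, h.mem_r_iff.2 ⟨_, _, rfl⟩,
      x₁ • e₁ + x₂ • e₂ + (y₁ • f₁ + y₂ • f₂) + ((-y₁) • g₁ + (-y₂) • g₂), ?_, by module⟩
    rw [Submodule.mem_inf, h.mem_perp_m, h.mem_perp_n]
    exact ⟨⟨by ring, by ring⟩, by linear_combination k₁, by linear_combination k₂⟩

/-- If the three spaces have a common nonzero vector, the pairing matrix is symmetric. -/
theorem symmetric_of_mem (h2 : (2 : F) ≠ 0) (hQ : IsElliptic Q) (hm : IsSingularLine Q m)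
    (h : IsFrame Q m n r e₁ e₂ f₁ f₂ g₁ g₂ a b c d) {v : V} (hv : v ≠ 0)
    (hvm : v ∈ m ⊔ (perp Q n ⊓ perp Q r)) (hvn : v ∈ n ⊔ (perp Q m ⊓ perp Q r))
    (hvr : v ∈ r ⊔ (perp Q m ⊓ perp Q n)) : b = c := by
  obtain ⟨x₁, x₂, y₁, y₂, z₁, z₂, rfl⟩ := h.exists_coords v
  rw [h.mem_sup_perp_m] at hvm
  rw [h.mem_sup_perp_n] at hvn
  rw [h.mem_sup_perp_r] at hvr
  obtain ⟨k₁, k₂⟩ := hvm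
  obtain ⟨k₃, k₄⟩ := hvn
  obtain ⟨k₅, k₆⟩ := hvr
  -- The six equations give (A + Aᵀ)(y - z) = 0, so twice the anisotropic form vanishes at y - z.
  obtain ⟨j₁, j₂⟩ := h.anisotropic h2 hQ hm (y₁ - z₁) (y₂ - z₂) (by
    apply mul_left_cancel₀ h2
    linear_combination (y₁ - z₁) * (k₃ - k₅ - k₁) + (y₂ - z₂) * (k₄ - k₆ - k₂))
  obtain rfl := sub_eq_zero.1 j₁
  obtain rfl := sub_eq_zero.1 j₂
  by_contra hbc
  have hbc' := sub_ne_zero.2 hbc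
  have hy₂ : y₂ = 0 :=
    (mul_eq_zero.1 (by linear_combination k₁ : (b - c) * y₂ = 0)).resolve_left hbc'
  have hy₁ : y₁ = 0 :=
    (mul_eq_zero.1 (by linear_combination -k₂ : (b - c) * y₁ = 0)).resolve_left hbc'
  subst hy₁ hy₂
  apply hv
  rw [k₃, k₄]
  simp

/-- If the pairing matrix is symmetric, the three spaces have a common line. -/
theorem exists_line_of_symmetric (hQ : IsElliptic Q)
    (h : IsFrame Q m n r e₁ e₂ f₁ f₂ g₁ g₂ a b c d) (hbc : b = c) :
    ∃ k : Submodule F V, Module.finrank F k = 2 ∧ k ≤ m ⊔ (perp Q n ⊓ perp Q r) ∧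
      k ≤ n ⊔ (perp Q m ⊓ perp Q r) ∧ k ≤ r ⊔ (perp Q m ⊓ perp Q n) := by
  subst hbc
  -- The common line consists of the vectors Ay·e + y·f + y·g; the two generators are y = (1, 0) and
  -- y = (0, 1).
  have hk : ∀ x ∈ Submodule.span F {a • e₁ + b • e₂ + f₁ + g₁, b • e₁ + d • e₂ + f₂ + g₂},
      ∃ s t : F, x = (a * s + b * t) • e₁ + (b * s + d * t) • e₂ + (s • f₁ + t • f₂) +
        (s • g₁ + t • g₂) := by
    intro x hx
    obtain ⟨s, t, rfl⟩ := Submodule.mem_span_pair.1 hx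
    exact ⟨s, t, by module⟩
  refine ⟨Submodule.span F {a • e₁ + b • e₂ + f₁ + g₁, b • e₁ + d • e₂ + f₂ + g₂},
    finrank_span_pair_eq_two ?_, fun x hx => ?_, fun x hx => ?_, fun x hx => ?_⟩
  · rw [LinearIndependent.pair_iff]
    intro s t hst
    obtain ⟨-, -, -, -, hs, ht⟩ := h.coords_eq_zero hQ (x₁ := a * s + b * t)
      (x₂ := b * s + d * t) (y₁ := s) (y₂ := t) (z₁ := s) (z₂ := t) (by rw [← hst]; module)
    exact ⟨hs, ht⟩
  · obtain ⟨s, t, rfl⟩ := hk x hx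
    exact h.mem_sup_perp_m.2 ⟨rfl, rfl⟩
  · obtain ⟨s, t, rfl⟩ := hk x hx
    exact h.mem_sup_perp_n.2 ⟨rfl, rfl⟩
  · obtain ⟨s, t, rfl⟩ := hk x hx
    exact h.mem_sup_perp_r.2 ⟨rfl, rfl⟩

/-! ### The hyperplane ⟨e₁, n, r⟩, given by x₂ = 0 -/

theorem mem_hyperplane_iff (hQ : IsElliptic Q) (h : IsFrame Q m n r e₁ e₂ f₁ f₂ g₁ g₂ a b c d)
    {x₁ x₂ y₁ y₂ z₁ z₂ : F} :
    x₁ • e₁ + x₂ • e₂ + (y₁ • f₁ + y₂ • f₂) + (z₁ • g₁ + z₂ • g₂) ∈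
        Submodule.span F {e₁} ⊔ n ⊔ r ↔ x₂ = 0 := by
  constructor
  · intro hv
    obtain ⟨u, hu, z, hz, hv⟩ := Submodule.mem_sup.1 hv
    obtain ⟨x, hx, y, hy, rfl⟩ := Submodule.mem_sup.1 hu
    obtain ⟨s₁, rfl⟩ := Submodule.mem_span_singleton.1 hx
    obtain ⟨s₃, s₄, rfl⟩ := h.mem_n_iff.1 hy
    obtain ⟨s₅, s₆, rfl⟩ := h.mem_r_iff.1 hz
    exact (h.coords_eq_zero hQ (x₁ := x₁ - s₁) (x₂ := x₂) (y₁ := y₁ - s₃) (y₂ := y₂ - s₄)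
      (z₁ := z₁ - s₅) (z₂ := z₂ - s₆) (by rw [← sub_eq_zero.2 hv.symm]; module)).2.1
  · rintro rfl
    rw [zero_smul, add_zero]
    exact Submodule.add_mem_sup (Submodule.add_mem_sup
      (Submodule.mem_span_singleton.2 ⟨_, rfl⟩) (h.mem_n_iff.2 ⟨_, _, rfl⟩))
      (h.mem_r_iff.2 ⟨_, _, rfl⟩)

theorem e₁_ne_zero (h : IsFrame Q m n r e₁ e₂ f₁ f₂ g₁ g₂ a b c d) : e₁ ≠ 0 := by
  rintro rfl
  have := h.ef₁₁
  rw [QuadraticMap.polar_zero_left] at this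
  exact zero_ne_one this

/-- `d` is the value of the anisotropic form at (0, 1). -/
theorem d_ne_zero (h2 : (2 : F) ≠ 0) (hQ : IsElliptic Q) (hm : IsSingularLine Q m)
    (h : IsFrame Q m n r e₁ e₂ f₁ f₂ g₁ g₂ a b c d) : d ≠ 0 := fun hd =>
  one_ne_zero (h.anisotropic h2 hQ hm 0 1 (by rw [hd]; ring)).2

theorem inf_hyperplane (hQ : IsElliptic Q) (h : IsFrame Q m n r e₁ e₂ f₁ f₂ g₁ g₂ a b c d) :
    m ⊓ (Submodule.span F {e₁} ⊔ n ⊔ r) = Submodule.span F {e₁} := by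
  apply le_antisymm
  · rintro x ⟨hx, hxH⟩
    obtain ⟨x₁, x₂, rfl⟩ := h.mem_m_iff.1 hx
    have : x₁ • e₁ + x₂ • e₂ + ((0 : F) • f₁ + (0 : F) • f₂) + ((0 : F) • g₁ + (0 : F) • g₂) ∈
        Submodule.span F {e₁} ⊔ n ⊔ r := by simpa using hxH
    rw [h.mem_hyperplane_iff hQ] at this
    subst this
    exact Submodule.mem_span_singleton.2 ⟨x₁, by simp⟩
  · rw [Submodule.span_singleton_le_iff_mem]
    exact ⟨h.mem_m_iff.2 ⟨1, 0, by simp⟩,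
      Submodule.mem_sup_left (Submodule.mem_sup_left (Submodule.mem_span_singleton_self e₁))⟩

theorem not_le_hyperplane (hQ : IsElliptic Q) (h : IsFrame Q m n r e₁ e₂ f₁ f₂ g₁ g₂ a b c d) :
    ¬ m ≤ Submodule.span F {e₁} ⊔ n ⊔ r := by
  intro hle
  have := hle (h.mem_m_iff.2 ⟨0, 1, rfl⟩)
  have h' : (0 : F) • e₁ + (1 : F) • e₂ + ((0 : F) • f₁ + (0 : F) • f₂) +
      ((0 : F) • g₁ + (0 : F) • g₂) ∈ Submodule.span F {e₁} ⊔ n ⊔ r := by simpa using this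
  rw [h.mem_hyperplane_iff hQ] at h'
  exact one_ne_zero h'

/-- A radical vector x₁e₁ + y·f + z·g satisfies Az = Aᵀy. For symmetric A anisotropy gives y = z,
and the pairings with `e₁`, `f₂` and `f₁` then kill y₁, y₂ and x₁ in turn. -/
theorem hyperplane_nondegenerate (h2 : (2 : F) ≠ 0) (hQ : IsElliptic Q) (hm : IsSingularLine Q m)
    (hn : IsSingularLine Q n) (hr : IsSingularLine Q r)
    (h : IsFrame Q m n r e₁ e₂ f₁ f₂ g₁ g₂ a b c d) (hbc : b = c) :
    IsNondegenerateHyperplane Q (Submodule.span F {e₁} ⊔ n ⊔ r) := by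
  have := hQ.finiteDimensional
  have hd := h.d_ne_zero h2 hQ hm
  subst hbc
  have he₁ : e₁ ∈ Submodule.span F {e₁} ⊔ n ⊔ r :=
    Submodule.mem_sup_left (Submodule.mem_sup_left (Submodule.mem_span_singleton_self e₁))
  have hf : n ≤ Submodule.span F {e₁} ⊔ n ⊔ r := le_sup_right.trans le_sup_left
  have hg : r ≤ Submodule.span F {e₁} ⊔ n ⊔ r := le_sup_right
  refine ⟨?_, ?_⟩
  -- The dimension is at most 1 + 2 + 2, and adding the single vector `e₂` gives all six dimensions.
  · have htop : Submodule.span F {e₁} ⊔ n ⊔ r ⊔ Submodule.span F {e₂} = ⊤ := by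
      rw [eq_top_iff]
      intro v _
      obtain ⟨x₁, x₂, y₁, y₂, z₁, z₂, rfl⟩ := h.exists_coords v
      refine Submodule.mem_sup.2 ⟨x₁ • e₁ + (0 : F) • e₂ + (y₁ • f₁ + y₂ • f₂) +
        (z₁ • g₁ + z₂ • g₂), (h.mem_hyperplane_iff hQ).2 rfl, x₂ • e₂,
        Submodule.mem_span_singleton.2 ⟨_, rfl⟩, by module⟩
    have i₁ := Submodule.finrank_add_le_finrank_add_finrank
      (Submodule.span F {e₁} ⊔ n ⊔ r) (Submodule.span F {e₂})
    have i₂ := Submodule.finrank_add_le_finrank_add_finrank (Submodule.span F {e₁} ⊔ n) r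
    have i₃ := Submodule.finrank_add_le_finrank_add_finrank (Submodule.span F {e₁}) n
    have i₄ := finrank_span_singleton (K := F) h.e₁_ne_zero
    have i₅ : Module.finrank F (Submodule.span F {e₂}) ≤ 1 := by
      simpa using finrank_span_le_card (R := F) ({e₂} : Set V)
    rw [htop, finrank_top, hQ.finrank_eq] at i₁
    have i₆ := hn.1
    have i₇ := hr.1
    rw [hQ.finrank_eq]
    omega
  · let _ : Invertible (2 : F) := invertibleOfNonzero h2
    rw [QuadraticMap.nondegenerate_iff_radical_eq_bot, QuadraticMap.radical_eq_ker_polarBilin,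
      LinearMap.ker_eq_bot']
    rintro ⟨v, hvH⟩ hv
    have hv' : ∀ u ∈ Submodule.span F {e₁} ⊔ n ⊔ r, QuadraticMap.polar Q u v = 0 := by
      intro u hu
      rw [QuadraticMap.polar_comm]
      exact congrArg (fun φ : _ →ₗ[F] F => φ ⟨u, hu⟩) hv
    obtain ⟨x₁, x₂, y₁, y₂, z₁, z₂, rfl⟩ := h.exists_coords v
    obtain rfl := (h.mem_hyperplane_iff hQ).1 hvH
    have k₀ := hv' e₁ he₁
    have k₁ := hv' f₁ (hf (h.mem_n_iff.2 ⟨1, 0, by simp⟩))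
    have k₂ := hv' f₂ (hf (h.mem_n_iff.2 ⟨0, 1, by simp⟩))
    have k₃ := hv' g₁ (hg (h.mem_r_iff.2 ⟨1, 0, by simp⟩))
    have k₄ := hv' g₂ (hg (h.mem_r_iff.2 ⟨0, 1, by simp⟩))
    rw [h.polar_e₁] at k₀
    rw [h.polar_f₁] at k₁
    rw [h.polar_f₂] at k₂
    rw [h.polar_g₁] at k₃
    rw [h.polar_g₂] at k₄
    obtain ⟨j₁, j₂⟩ := h.anisotropic h2 hQ hm (y₁ - z₁) (y₂ - z₂) (by
      linear_combination (y₁ - z₁) * (k₃ - k₁) + (y₂ - z₂) * (k₄ - k₂))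
    obtain rfl := sub_eq_zero.1 j₁
    obtain rfl := sub_eq_zero.1 j₂
    have hy₁ : y₁ = 0 :=
      (mul_eq_zero.1 (by linear_combination k₀ : 2 * y₁ = 0)).resolve_left h2
    subst hy₁
    have hy₂ : y₂ = 0 :=
      (mul_eq_zero.1 (by linear_combination k₂ : d * y₂ = 0)).resolve_left hd
    subst hy₂
    have hx₁ : x₁ = 0 := by linear_combination k₁
    subst hx₁
    exact Subtype.ext (by simp)

end IsFrame

/-! ### Existence of frames -/

theorem inf_eq_bot_of_sup_eq_top (hV : Module.finrank F V = 6) (hm : Module.finrank F m = 2)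
    (hn : Module.finrank F n = 2) (hr : Module.finrank F r = 2) (h : m ⊔ n ⊔ r = ⊤) :
    m ⊓ n = ⊥ := by
  have : FiniteDimensional F V := Module.finite_of_finrank_pos (by omega)
  have h₁ := Submodule.finrank_add_le_finrank_add_finrank (m ⊔ n) r
  have h₂ := Submodule.finrank_sup_add_finrank_inf_eq m n
  rw [h, finrank_top] at h₁
  exact Submodule.finrank_eq_zero.1 (by omega)

/-- The first vector is prescribed so that it can span the point of a given flag. -/
theorem exists_isFrame (hQ : IsElliptic Q) (hm : IsSingularLine Q m) (hn : IsSingularLine Q n)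
    (hr : IsSingularLine Q r) (h : m ⊔ n ⊔ r = ⊤) {e₁ : V} (he : e₁ ∈ m) (he0 : e₁ ≠ 0) :
    ∃ (e₂ f₁ f₂ g₁ g₂ : V) (a b c d : F), IsFrame Q m n r e₁ e₂ f₁ f₂ g₁ g₂ a b c d := by
  have := hQ.finiteDimensional
  obtain ⟨e₂, he₂, he₂'⟩ : ∃ v, v ∈ m ∧ v ∉ Submodule.span F {e₁} := by
    by_contra! hcon
    have h₁ := Submodule.finrank_mono (show m ≤ Submodule.span F {e₁} from hcon)
    have h₂ := finrank_span_singleton (K := F) he0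
    have h₃ := hm.1
    omega
  have hme := eq_span_pair hm.1 he he₂ he0 he₂'
  obtain ⟨f₁, f₂, hf, k₁, k₂, k₃, k₄⟩ := exists_dual_pair hQ hm hn
    (inf_eq_bot_of_sup_eq_top hQ.finrank_eq hm.1 hn.1 hr.1 h) hme
  obtain ⟨g₁, g₂, hg, j₁, j₂, j₃, j₄⟩ := exists_dual_pair hQ hm hr
    (inf_eq_bot_of_sup_eq_top hQ.finrank_eq hm.1 hr.1 hn.1 (by rw [sup_right_comm, h])) hme
  exact ⟨e₂, f₁, f₂, g₁, g₂, _, _, _, _, hme, hf, hg, hm.2, hn.2, hr.2, k₁, k₂, k₃, k₄,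
    j₁, j₂, j₃, j₄, rfl, rfl, rfl, rfl, h⟩

/-! ### Lines through e₁ and the induced involution -/

/-- Two vectors that are singular and orthogonal span a totally singular line. -/
theorem isSingularLine_span_pair {u v : V} (hli : LinearIndependent F ![u, v]) (hu : Q u = 0)
    (hv : Q v = 0) (huv : QuadraticMap.polar Q u v = 0) :
    IsSingularLine Q (Submodule.span F {u, v}) := by
  refine ⟨finrank_span_pair_eq_two hli, fun x hx => ?_⟩
  obtain ⟨s, t, rfl⟩ := Submodule.mem_span_pair.1 hx
  rw [map_comb, hu, hv, huv]
  ring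

theorem IsSingularLine.le_perp (hm : IsSingularLine Q m) {B : Submodule F V} (hB : B ≤ m) :
    m ≤ perp Q B := fun _ hx _ hy => polar_eq_zero hm.2 (hB hy) hx

namespace IsFrame

variable {e₁ e₂ f₁ f₂ g₁ g₂ : V} {a b c d : F}

/-- The frame obtained by exchanging the second and the third line. -/
theorem swap (h : IsFrame Q m n r e₁ e₂ f₁ f₂ g₁ g₂ a b c d) :
    IsFrame Q m r n e₁ e₂ g₁ g₂ f₁ f₂ a c b d where
  eq_m := h.eq_m
  eq_n := h.eq_r
  eq_r := h.eq_n
  singular_m := h.singular_m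
  singular_n := h.singular_r
  singular_r := h.singular_n
  ef₁₁ := h.eg₁₁
  ef₁₂ := h.eg₁₂
  ef₂₁ := h.eg₂₁
  ef₂₂ := h.eg₂₂
  eg₁₁ := h.ef₁₁
  eg₁₂ := h.ef₁₂
  eg₂₁ := h.ef₂₁
  eg₂₂ := h.ef₂₂
  fg₁₁ := by rw [QuadraticMap.polar_comm, h.fg₁₁]
  fg₁₂ := by rw [QuadraticMap.polar_comm, h.fg₂₁]
  fg₂₁ := by rw [QuadraticMap.polar_comm, h.fg₁₂]
  fg₂₂ := by rw [QuadraticMap.polar_comm, h.fg₂₂]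
  sup_eq_top := by rw [sup_right_comm, h.sup_eq_top]

theorem f₂_mem (h : IsFrame Q m n r e₁ e₂ f₁ f₂ g₁ g₂ a b c d) : f₂ ∈ n :=
  h.mem_n_iff.2 ⟨0, 1, by simp⟩

theorem isSingularLine_span_e₁_f₂ (hQ : IsElliptic Q)
    (h : IsFrame Q m n r e₁ e₂ f₁ f₂ g₁ g₂ a b c d) :
    IsSingularLine Q (Submodule.span F {e₁, f₂}) := by
  refine isSingularLine_span_pair ?_ (h.singular_m e₁ (h.mem_m_iff.2 ⟨1, 0, by simp⟩))
    (h.singular_n _ h.f₂_mem) h.ef₁₂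
  rw [LinearIndependent.pair_iff]
  intro s t hst
  obtain ⟨hs, -, -, ht, -⟩ := h.coords_eq_zero hQ (x₁ := s) (x₂ := 0) (y₁ := 0) (y₂ := t)
    (z₁ := 0) (z₂ := 0) (by rw [← hst]; module)
  exact ⟨hs, ht⟩

/-- The totally singular line through `e₁` that meets the second line. -/
theorem eq_span_of_concurrent (hQ : IsElliptic Q) (h : IsFrame Q m n r e₁ e₂ f₁ f₂ g₁ g₂ a b c d)
    {p : Submodule F V} (hp : IsSingularLine Q p) (hep : e₁ ∈ p) (hpn : p ⊓ n ≠ ⊥) :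
    p = Submodule.span F {e₁, f₂} := by
  obtain ⟨y, ⟨hyp, hyn⟩, hy0⟩ := Submodule.exists_mem_ne_zero_of_ne_bot hpn
  have hey := polar_eq_zero hp.2 hep hyp
  obtain ⟨s, t, rfl⟩ := h.mem_n_iff.1 hyn
  rw [QuadraticMap.polar_add_right, QuadraticMap.polar_smul_right, QuadraticMap.polar_smul_right,
    h.ef₁₁, h.ef₁₂] at hey
  -- The common point with `n` is orthogonal to `e₁`, and its pairing with `e₁` is its
  -- `f₁`-coordinate; so the point is ⟨f₂⟩.
  have hs : s = 0 := by simpa using hey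
  subst hs
  rw [zero_smul, zero_add] at hy0 hyp
  have ht : t ≠ 0 := fun ht => hy0 (by rw [ht, zero_smul])
  refine eq_span_pair hp.1 hep ((p.smul_mem_iff ht).1 hyp) h.e₁_ne_zero fun hf => ?_
  obtain ⟨w, hw⟩ := Submodule.mem_span_singleton.1 hf
  exact one_ne_zero (h.coords_eq_zero hQ (x₁ := -w) (x₂ := 0) (y₁ := 0) (y₂ := 1) (z₁ := 0)
    (z₂ := 0) (by rw [← hw]; module)).2.2.2.1

/-- If the involution exchanges the lines through `e₁` meeting the second and the third line,
the pairing matrix is symmetric. -/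
theorem symmetric_of_le_sup_sigma (h2 : (2 : F) ≠ 0) (hQ : IsElliptic Q) (hm : IsSingularLine Q m)
    (h : IsFrame Q m n r e₁ e₂ f₁ f₂ g₁ g₂ a b c d)
    (hle : g₂ ∈ Submodule.span F {e₁, f₂} ⊔ sigma Q m (Submodule.span F {e₁} ⊔ n ⊔ r)) :
    b = c := by
  obtain ⟨u, hu, s, ⟨hs, -⟩, hus⟩ := Submodule.mem_sup.1 hle
  obtain ⟨x, hx, w, hw, rfl⟩ := Submodule.mem_sup.1 hs
  obtain ⟨s, t, rfl⟩ := Submodule.mem_span_pair.1 hu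
  obtain ⟨x₁, x₂, rfl⟩ := h.mem_m_iff.1 hx
  -- Solving for the component `w` in the pole of the hyperplane: its `f₁`- and `g₁`-coordinates are
  -- zero and its `g₂`-coordinate is 1.
  have hw' : w = (-s - x₁) • e₁ + (-x₂) • e₂ + ((0 : F) • f₁ + (-t) • f₂) +
      ((0 : F) • g₁ + (1 : F) • g₂) := by
    rw [one_smul, ← hus]
    module
  have hwn : w ∈ perp Q n := fun y hy => hw y (Submodule.mem_sup_left (Submodule.mem_sup_right hy))
  have hwr : w ∈ perp Q r := fun y hy => hw y (Submodule.mem_sup_right hy)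
  rw [hw', h.mem_perp_n] at hwn
  rw [hw', h.mem_perp_r] at hwr
  -- Orthogonality to `f₂` and to `g₂` gives d = -dt, and `d` is nonzero. With t = -1, orthogonality
  -- to `f₁` and to `g₁` compares b with c.
  have ht : t = -1 := by
    apply mul_left_cancel₀ (h.d_ne_zero h2 hQ hm)
    linear_combination hwn.2 - hwr.2
  subst ht
  linear_combination hwn.1 - hwr.1

/-- Correcting f₂ + g₂ by the vector b·e₁ + d·e₂ of `m` makes it orthogonal to the hyperplane. This
puts `g₂` in the plane spanned by ⟨e₁, f₂⟩ and σ. -/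
theorem f₂_add_g₂_mem_sigma (h : IsFrame Q m n r e₁ e₂ f₁ f₂ g₁ g₂ a b c d)
    (hbc : b = c) : f₂ + g₂ ∈ sigma Q m (Submodule.span F {e₁} ⊔ n ⊔ r) := by
  -- The `e`-coefficients are forced: orthogonality to `n` asks for (-b, -d) and orthogonality to
  -- `r` for (-c, -d), which agree by symmetry.
  obtain ⟨w, hw⟩ : ∃ w, w = (-b) • e₁ + (-d) • e₂ + ((0 : F) • f₁ + (1 : F) • f₂) +
      ((0 : F) • g₁ + (1 : F) • g₂) := ⟨_, rfl⟩
  have hwe : QuadraticMap.polar Q e₁ w = 0 := by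
    rw [hw, h.polar_e₁, add_zero]
  have hwn : w ∈ perp Q n := by
    rw [hw, h.mem_perp_n]
    exact ⟨by ring, by ring⟩
  have hwr : w ∈ perp Q r := by
    rw [hw, h.mem_perp_r, hbc]
    exact ⟨by ring, by ring⟩
  have hwH : w ∈ perp Q (Submodule.span F {e₁} ⊔ n ⊔ r) :=
    mem_perp_sup (mem_perp_sup (mem_perp_span_singleton hwe) hwn) hwr
  rw [sigma, Submodule.mem_inf]
  refine ⟨Submodule.mem_sup.2 ⟨b • e₁ + d • e₂, h.mem_m_iff.2 ⟨_, _, rfl⟩, w, hwH, ?_⟩,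
    Submodule.add_mem _ (Submodule.mem_sup_left (Submodule.mem_sup_right h.f₂_mem))
      (Submodule.mem_sup_right h.swap.f₂_mem)⟩
  rw [hw]
  module

/-- If the pairing matrix is symmetric, the involution exchanges the lines through `e₁` meeting
the second and the third line. -/
theorem sigmaTilde (h2 : (2 : F) ≠ 0) (hQ : IsElliptic Q) (hm : IsSingularLine Q m)
    (hn : IsSingularLine Q n) (hr : IsSingularLine Q r)
    (h : IsFrame Q m n r e₁ e₂ f₁ f₂ g₁ g₂ a b c d) (hbc : b = c) :
    SigmaTilde Q m (Submodule.span F {e₁} ⊔ n ⊔ r) (Submodule.span F {e₁, f₂})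
      (Submodule.span F {e₁, g₂}) := by
  have he : Submodule.span F {e₁} ≤ Submodule.span F {e₁} ⊔ n ⊔ r :=
    le_sup_left.trans le_sup_left
  have hf : f₂ ∈ Submodule.span F {e₁} ⊔ n ⊔ r :=
    Submodule.mem_sup_left (Submodule.mem_sup_right h.f₂_mem)
  have hg : g₂ ∈ Submodule.span F {e₁} ⊔ n ⊔ r := Submodule.mem_sup_right h.swap.f₂_mem
  have hgen : ∀ v ∈ Submodule.span F {e₁} ⊔ n ⊔ r, IsSingularLine Q (Submodule.span F {e₁, v}) →
      IsConeGenerator Q (m ⊓ (Submodule.span F {e₁} ⊔ n ⊔ r)) (Submodule.span F {e₁} ⊔ n ⊔ r)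
        (Submodule.span F {e₁, v}) := by
    intro v hv hl
    rw [h.inf_hyperplane hQ]
    have hB : Submodule.span F {e₁} ≤ Submodule.span F {e₁, v} :=
      Submodule.span_mono (by simp)
    refine ⟨hl, hB, le_inf (hl.le_perp hB) ?_⟩
    rw [Submodule.span_le]
    rintro x (rfl | rfl)
    exacts [he (Submodule.mem_span_singleton_self _), hv]
  refine ⟨h.hyperplane_nondegenerate h2 hQ hm hn hr hbc, h.not_le_hyperplane hQ,
    hgen _ hf (h.isSingularLine_span_e₁_f₂ hQ), hgen _ hg (h.swap.isSingularLine_span_e₁_f₂ hQ),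
    fun heq => ?_, ?_⟩
  · have : g₂ ∈ Submodule.span F {e₁, f₂} := by
      rw [← heq]
      exact Submodule.subset_span (by simp)
    obtain ⟨s, t, hst⟩ := Submodule.mem_span_pair.1 this
    exact one_ne_zero (h.coords_eq_zero hQ (x₁ := -s) (x₂ := 0) (y₁ := 0) (y₂ := -t) (z₁ := 0)
      (z₂ := 1) (by rw [one_smul, ← hst]; module)).2.2.2.2.2
  · rw [Submodule.span_le]
    rintro x (rfl | rfl)
    · exact Submodule.mem_sup_left (Submodule.subset_span (by simp))
    · have hfx := h.f₂_add_g₂_mem_sigma hbc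
      have hx : x = -f₂ + (f₂ + x) := by abel
      rw [hx]
      exact Submodule.add_mem_sup (neg_mem (Submodule.subset_span (by simp))) hfx

end IsFrame

/-! ### Index bookkeeping and the equivalence -/

/-- The cyclic convention for the indices is harmless because intersection is commutative. -/
theorem perspSpace_eq (l T : Fin 3 → Submodule F V) {i j k : Fin 3} (hij : i ≠ j) (hjk : j ≠ k)
    (hki : k ≠ i) : perspSpace l T i = l i ⊔ (T j ⊓ T k) := by
  have h : (j = i + 1 ∧ k = i + 2) ∨ (k = i + 1 ∧ j = i + 2) := by omega
  rcases h with ⟨rfl, rfl⟩ | ⟨rfl, rfl⟩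
  · rfl
  · rw [perspSpace, inf_comm]

theorem sup_eq_top_of_iSup_eq_top {l : Fin 3 → Submodule F V} (h : ⨆ i, l i = ⊤) {i j k : Fin 3}
    (hij : i ≠ j) (hjk : j ≠ k) (hki : k ≠ i) : l i ⊔ l j ⊔ l k = ⊤ := by
  rw [eq_top_iff, ← h, iSup_le_iff]
  intro t
  have ht : t = i ∨ t = j ∨ t = k := by omega
  rcases ht with rfl | rfl | rfl
  exacts [le_sup_left.trans le_sup_left, le_sup_right.trans le_sup_left, le_sup_right]

theorem finrank_perp (h2 : (2 : F) ≠ 0) (hQ : IsElliptic Q) (hm : IsSingularLine Q m) :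
    Module.finrank F (perp Q m) = 4 := by
  let _ : Invertible (2 : F) := invertibleOfNonzero h2
  have := hQ.finiteDimensional
  have h := LinearMap.BilinForm.finrank_orthogonal
    (QuadraticMap.nondegenerate_polar_iff.2 hQ.nondegenerate) m
  rw [hQ.finrank_eq, hm.1] at h
  exact h

end EllipticQuadric

open EllipticQuadric in
/-- Three distinct lines of `Q^-(5,q)`, `q` odd, that span the space are in perspective if and only
if, for some flag `(B, l_i)`, the totally singular lines through `B` concurrent with `l_j` and
with `l_k` correspond under the involution defined by the hyperplane `⟨B, l_j, l_k⟩`. -/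
theorem proposition3p4 {F V : Type*} [Field F] [Finite F] [AddCommGroup V] [Module F V]
    (hq : Odd (Nat.card F)) (Q : QuadraticForm F V) (hQ : IsElliptic Q)
    (l : Fin 3 → Submodule F V) (hl : ∀ i, IsSingularLine Q (l i))
    (hdist : Function.Injective l) (hspan : ⨆ i, l i = ⊤) :
    InPerspective Q l ↔
      ∃ i j k : Fin 3, i ≠ j ∧ j ≠ k ∧ k ≠ i ∧
        ∃ B : Submodule F V, IsFlag Q B (l i) ∧
          ∃ p p' : Submodule F V,
            (IsSingularLine Q p ∧ B ≤ p ∧ Concurrent p (l j)) ∧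
            (IsSingularLine Q p' ∧ B ≤ p' ∧ Concurrent p' (l k)) ∧
            SigmaTilde Q (l i) (B ⊔ l j ⊔ l k) p p' := by
  have h2 := two_ne_zero_of_odd_card hq
  have hskew : ∀ i j, i ≠ j → l i ⊓ l j = ⊥ := by
    intro i j hij
    obtain ⟨k, hjk, hki⟩ : ∃ k, j ≠ k ∧ k ≠ i := by
      revert i j
      decide
    exact inf_eq_bot_of_sup_eq_top hQ.finrank_eq (hl i).1 (hl j).1 (hl k).1
      (sup_eq_top_of_iSup_eq_top hspan hij hjk hki)
  constructor
  · intro h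
    obtain ⟨k, hk, hle⟩ := h.exists_line
    obtain ⟨v, hv, hv0⟩ := Submodule.exists_mem_ne_zero_of_ne_bot
      (p := k) (by rintro rfl; rw [finrank_bot] at hk; omega)
    -- Any point of `l 0` will do: the common vector `v` makes the pairing matrix symmetric in every
    -- frame.
    obtain ⟨e₁, he, he0⟩ := Submodule.exists_mem_ne_zero_of_ne_bot
      (p := l 0) (by intro h0; have := (hl 0).1; rw [h0, finrank_bot] at this; omega)
    obtain ⟨e₂, f₁, f₂, g₁, g₂, a, b, c, d, hF⟩ := exists_isFrame hQ (hl 0) (hl 1) (hl 2)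
      (sup_eq_top_of_iSup_eq_top hspan (by decide) (by decide) (by decide)) he he0
    have hv₀ := hle 0 hv
    have hv₁ := hle 1 hv
    have hv₂ := hle 2 hv
    rw [perspSpace_eq l _ (i := 0) (j := 1) (k := 2) (by decide) (by decide) (by decide)] at hv₀
    rw [perspSpace_eq l _ (i := 1) (j := 0) (k := 2) (by decide) (by decide) (by decide)] at hv₁
    rw [perspSpace_eq l _ (i := 2) (j := 0) (k := 1) (by decide) (by decide) (by decide)] at hv₂
    have hbc := hF.symmetric_of_mem h2 hQ (hl 0) hv0 hv₀ hv₁ hv₂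
    have hconc : ∀ {i : Fin 3} {u : V}, i ≠ 0 → u ∈ l i → u ≠ 0 →
        Concurrent (Submodule.span F {e₁, u}) (l i) := by
      intro i u hi hu hu0
      refine ⟨fun heq => he0 ?_, fun hbot => hu0 ?_⟩
      · have : e₁ ∈ l i ⊓ l 0 := ⟨heq ▸ Submodule.subset_span (by simp), he⟩
        rwa [hskew i 0 hi, Submodule.mem_bot] at this
      · have : u ∈ Submodule.span F {e₁, u} ⊓ l i := ⟨Submodule.subset_span (by simp), hu⟩
        rwa [hbot, Submodule.mem_bot] at this
    have hB : ∀ u : V, Submodule.span F {e₁} ≤ Submodule.span F {e₁, u} := fun u =>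
      Submodule.span_mono (by simp)
    refine ⟨0, 1, 2, by decide, by decide, by decide, Submodule.span F {e₁},
      ⟨finrank_span_singleton he0, hl 0, by rwa [Submodule.span_singleton_le_iff_mem]⟩,
      Submodule.span F {e₁, f₂}, Submodule.span F {e₁, g₂},
      ⟨hF.isSingularLine_span_e₁_f₂ hQ, hB _, hconc (by decide) hF.f₂_mem ?_⟩,
      ⟨hF.swap.isSingularLine_span_e₁_f₂ hQ, hB _, hconc (by decide) hF.swap.f₂_mem ?_⟩,
      hF.sigmaTilde h2 hQ (hl 0) (hl 1) (hl 2) hbc⟩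
    · rintro rfl
      simpa using hF.ef₂₂
    · rintro rfl
      simpa using hF.eg₂₂
  · rintro ⟨i, j, k, hij, hjk, hki, B, hB, p, p', ⟨hp, hBp, hpj⟩, ⟨hp', hBp', hpk⟩, hσ⟩
    obtain ⟨e₁, he, he0⟩ := Submodule.exists_mem_ne_zero_of_ne_bot
      (p := B) (by intro h0; have := hB.1; rw [h0, finrank_bot] at this; omega)
    have := hQ.finiteDimensional
    have hBe : B = Submodule.span F {e₁} := by
      symm
      apply Submodule.eq_of_le_of_finrank_eq
      · rwa [Submodule.span_singleton_le_iff_mem]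
      · rw [finrank_span_singleton he0, hB.1]
    obtain ⟨e₂, f₁, f₂, g₁, g₂, a, b, c, d, hF⟩ := exists_isFrame hQ (hl i) (hl j) (hl k)
      (sup_eq_top_of_iSup_eq_top hspan hij hjk hki) (hB.2.2 he) he0
    have hp_eq := hF.eq_span_of_concurrent hQ hp (hBp he) hpj.2
    have hp_eq' := hF.swap.eq_span_of_concurrent hQ hp' (hBp' he) hpk.2
    have hle := hσ.le_plane
    -- In the frame starting at B the two given lines become ⟨e₁, f₂⟩ and ⟨e₁, g₂⟩, so the plane
    -- condition concerns `g₂` alone.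
    rw [hp_eq, hp_eq', hBe] at hle
    have hbc := hF.symmetric_of_le_sup_sigma h2 hQ (hl i) (hle (Submodule.subset_span (by simp)))
    obtain ⟨t, ht, hti, htj, htk⟩ := hF.exists_line_of_symmetric hQ hbc
    refine ⟨fun i => (hl i).1, hskew, fun i => finrank_perp h2 hQ (hl i),
      fun i => (hl i).le_perp le_rfl, fun i' j' hne => ?_, t, ht, fun s => ?_⟩
    -- A point of one line lying in the polar of another is singular, hence on that other line by
    -- maximality, against skewness.
    · rw [eq_bot_iff, ← hskew i' j' hne]
      rintro x ⟨hx, hxj⟩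
      exact ⟨(hl i').mem_of_perp hQ hx ((hl j').2 x hxj), hxj⟩
    · have hs : s = i ∨ s = j ∨ s = k := by omega
      rcases hs with rfl | rfl | rfl
      · rwa [perspSpace_eq l _ hij hjk hki]
      · rwa [perspSpace_eq l _ hij.symm hki.symm hjk.symm]
      · rwa [perspSpace_eq l _ hki hij hjk]
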